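/- Let $D\subset\mathbb C$ be a domain (a nonempty connected open set), let $\alpha>1$ and $C>0$ be real numbers, and let $\mathcal F_{\alpha,C}(D)$ be the family of all functions $f$ meromorphic in $D$ such that $$\frac{|f'(z)|}{1+|f(z)|^{\alpha}}>C\qquad\text{for every } z\in D \text{ that is not a pole of } f.$$ Then $\mathcal F_{\alpha,C}(D)$ is normal in $D$: every sequence of functions in $\mathcal F_{\alpha,C}(D)$ has a subsequence that converges uniformly on compact subsets of $D$ with respect to the chordal metric on the Riemann sphere $\mathbb C\cup\{\infty\}$ (the limit being a function on $D$ with values in $\mathbb C\cup\{\infty\}$). -/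

import Mathlib

/-- The chordal metric on the Riemann sphere `ℂ ∪ {∞}`. -/
noncomputable def chordalDist (a b : OnePoint ℂ) : ℝ :=
  match a, b with
  | some z, some w => ‖z - w‖ / (Real.sqrt (1 + ‖z‖ ^ 2) * Real.sqrt (1 + ‖w‖ ^ 2))
  | some z, none => 1 / Real.sqrt (1 + ‖z‖ ^ 2)
  | none, some w => 1 / Real.sqrt (1 + ‖w‖ ^ 2)
  | none, none => 0

/-- `z` is a pole of `f`. -/
def IsPoleAt (f : ℂ → ℂ) (z : ℂ) : Prop := meromorphicOrderAt f z < 0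

open Classical in
/-- The value at `z` of a meromorphic function `f` (in normal form), as a point of the Riemann
sphere: `∞` at the poles and `f z` elsewhere. -/
noncomputable def sphereValue (f : ℂ → ℂ) (z : ℂ) : OnePoint ℂ :=
  if IsPoleAt f z then OnePoint.infty else ((f z : ℂ) : OnePoint ℂ)

/-- The functions `h n` converge to `g` in the chordal metric, uniformly on compact subsets
of `D`. -/
def ConvergesSpherically (h : ℕ → ℂ → OnePoint ℂ) (g : ℂ → OnePoint ℂ) (D : Set ℂ) : Prop :=
  ∀ K : Set ℂ, K ⊆ D → IsCompact K → ∀ ε : ℝ, 0 < ε →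
    ∃ N : ℕ, ∀ n : ℕ, N ≤ n → ∀ z ∈ K, chordalDist (h n z) (g z) < ε

/-- A family of meromorphic functions (in normal form on `D`) is normal in `D`: every sequence in
the family has a subsequence that converges in the chordal metric, uniformly on compact subsets of
`D`. (The limit is then automatically meromorphic or identically `∞` on each component.) -/
def IsNormalFamily (F : Set (ℂ → ℂ)) (D : Set ℂ) : Prop :=
  ∀ u : ℕ → ℂ → ℂ, (∀ n, u n ∈ F) →
    ∃ (φ : ℕ → ℕ) (g : ℂ → OnePoint ℂ), StrictMono φ ∧
      ConvergesSpherically (fun n => sphereValue (u (φ n))) g D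

/-- The family of all functions `f` meromorphic in `D` with `|f'| / (1 + |f| ^ α) > C` in `D`.
A meromorphic function is represented by its normal form: it is analytic off its poles, without
removable singularities, and its (junk) values at the poles are not used. The inequality is
imposed at the points where `f` is finite. -/
def derivGrowthFamily (α C : ℝ) (D : Set ℂ) : Set (ℂ → ℂ) :=
  {f | MeromorphicNFOn f D ∧
    ∀ z ∈ D, ¬ IsPoleAt f z → C < ‖deriv f z‖ / (1 + ‖f z‖ ^ α)}

open Filter Topology Metric Set

/-! For `f` in the family put `U = 1 / f'` and `V = f / f'`. Both are holomorphic on `D`, poles of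
`f` included, and bounded by `C⁻¹`, so along a subsequence they converge to holomorphic `u`, `v`.
Where `u ≠ 0`, `f = V / U` converges to `v / u`. Near a zero of `u` one uses `1 / f = U' / (V' -
1)`, which needs `v' ≠ 1` there (`deriv_ne_one_of_eq_zero`). Two relations that survive the limit
give this: `U' V = U (V' - 1)` and `|V| ^ α ≤ C⁻¹ |U| ^ (α - 1)`. Since `α > 1`, the second makes
`v` vanish wherever `u` does; if `v' = 1` at such a point, the first gives contradictory orders of
vanishing. -/

/-- **Montel's theorem** for sequences of uniformly bounded holomorphic functions. -/
theorem exists_subseq_tendstoLocallyUniformlyOn {D : Set ℂ} (hD : IsOpen D) {M : ℝ}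
    {F : ℕ → ℂ → ℂ} (hF : ∀ n, DifferentiableOn ℂ (F n) D) (hM : ∀ n, ∀ z ∈ D, ‖F n z‖ ≤ M) :
    ∃ (φ : ℕ → ℕ) (f : ℂ → ℂ), StrictMono φ ∧
      TendstoLocallyUniformlyOn (fun n => F (φ n)) f atTop D := by
  classical
  have : LocallyCompactSpace D := hD.locallyCompactSpace
  let G : ℕ → C(D, ℂ) := fun n => ⟨fun z => F n z, (hF n).continuousOn.domRestrict⟩
  have hequi : Equicontinuous (fun n => (G n : D → ℂ)) := by
    intro x
    obtain ⟨r, hr, hrD⟩ := Metric.isOpen_iff.1 hD x x.2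
    -- Schwarz lemma: each `F n` maps the ball of radius `r` about `x` into the closed ball of
    -- radius `M + M` about `F n x`.
    refine Metric.equicontinuousAt_of_continuity_modulus
      (fun z : D => (M + M) / r * dist z x) ?_ _ ?_
    · have : Continuous fun z : D => (M + M) / r * dist z x := by fun_prop
      simpa using this.tendsto x
    · filter_upwards [ball_mem_nhds x hr] with z hz n
      rw [dist_comm]
      refine Complex.dist_le_div_mul_dist_of_mapsTo_ball ((hF n).mono hrD) (fun w hw => ?_) hz
      rw [mem_closedBall]
      exact (dist_le_norm_add_norm _ _).trans (add_le_add (hM n w (hrD hw)) (hM n x x.2))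
  let S : Set C(D, ℂ) := closure (range G)
  have hpw : ∀ g ∈ S, ∀ x : D, g x ∈ closedBall (0 : ℂ) M := by
    intro g hg x
    have hc : IsClosed {g : C(D, ℂ) | g x ∈ closedBall (0 : ℂ) M} :=
      isClosed_closedBall.preimage (continuous_eval_const x)
    refine hc.closure_subset_iff.2 ?_ hg
    rintro _ ⟨n, rfl⟩
    exact mem_closedBall_zero_iff.2 (hM n x x.2)
  have hS : IsCompact S := by
    have : T2Space (UniformOnFun D ℂ {K | IsCompact K}) :=
      UniformOnFun.t2Space_of_covering
        (eq_univ_iff_forall.mpr fun x => mem_sUnion_of_mem (mem_singleton x) isCompact_singleton)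
    have := ArzelaAscoli.isCompact_closure_of_isClosedEmbedding (ι := C(D, ℂ)) (α := ℂ)
      (F := fun g => (g : D → ℂ)) (𝔖 := {K : Set D | IsCompact K}) (s := range G)
      (fun K hK => hK)
    refine this ?_ ?_ ?_
    · exact ContinuousMap.isUniformEmbedding_toUniformOnFunIsCompact.isClosedEmbedding
    · intro K _
      refine Equicontinuous.equicontinuousOn ?_ K
      intro x U hU
      filter_upwards [hequi x U hU] with y hy
      rintro ⟨_, n, rfl⟩
      exact hy n
    · intro K _ x _
      refine ⟨closedBall 0 M, isCompact_closedBall _ _, ?_⟩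
      rintro g hg
      exact hpw g (subset_closure hg) x
  obtain ⟨g, -, φ, hφ, hg⟩ := hS.tendsto_subseq (x := G) (fun n => subset_closure ⟨n, rfl⟩)
  refine ⟨φ, fun z => if h : z ∈ D then g ⟨z, h⟩ else 0, hφ, ?_⟩
  rw [tendstoLocallyUniformlyOn_iff_tendstoLocallyUniformly_comp_coe]
  rw [ContinuousMap.tendsto_iff_tendstoLocallyUniformly] at hg
  have hcomp : (fun z => if h : z ∈ D then g ⟨z, h⟩ else 0) ∘ ((↑) : D → ℂ) = g := by
    ext x
    simp
  rwa [hcomp]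

/-! ### Local behaviour of `1 / f'` and `f / f'`, including at poles -/

section Derivative

variable {f : ℂ → ℂ} {z : ℂ}

theorem MeromorphicNFAt.analyticAt_of_not_isPoleAt (hf : MeromorphicNFAt f z)
    (hz : ¬ IsPoleAt f z) : AnalyticAt ℂ f z :=
  hf.meromorphicOrderAt_nonneg_iff_analyticAt.1 (not_lt.1 hz)

theorem AnalyticAt.not_isPoleAt (hf : AnalyticAt ℂ f z) : ¬ IsPoleAt f z :=
  not_lt.2 hf.meromorphicOrderAt_nonneg

/-- The default value of `deriv` at a pole makes `(deriv f)⁻¹` and `f / deriv f` equal to `0` there,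
which is exactly the value of their holomorphic extensions. -/
theorem IsPoleAt.deriv_eq_zero (hz : IsPoleAt f z) : deriv f z = 0 := by
  refine deriv_zero_of_not_differentiableAt fun hd => ?_
  exact (((meromorphicAt_of_meromorphicOrderAt_ne_zero hz.ne).analyticAt
    hd.continuousAt).not_isPoleAt) hz

theorem MeromorphicAt.analyticAt_of_order_pos {g : ℂ → ℂ} (hg : 0 < meromorphicOrderAt g z)
    (h0 : g z = 0) : AnalyticAt ℂ g z := by
  refine (meromorphicAt_of_meromorphicOrderAt_ne_zero hg.ne').analyticAt ?_
  rw [continuousAt_iff_punctured_nhds, h0]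
  exact tendsto_zero_of_meromorphicOrderAt_pos hg

theorem IsPoleAt.exists_order (hz : IsPoleAt f z) :
    ∃ n : ℤ, n < 0 ∧ meromorphicOrderAt f z = n ∧ meromorphicOrderAt (deriv f) z = (n - 1 : ℤ) := by
  obtain ⟨n, hn⟩ := WithTop.ne_top_iff_exists.1 (ne_top_of_lt hz)
  have hn0 : n < 0 := by
    have := hz
    rw [IsPoleAt, ← hn] at this
    exact_mod_cast this
  exact ⟨n, hn0, hn.symm, meromorphicOrderAt_deriv_eq_sub_one (by exact_mod_cast hn0.ne) hn.symm⟩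

theorem MeromorphicNFAt.analyticAt_div_deriv (hf : MeromorphicNFAt f z)
    (h : ¬ IsPoleAt f z → deriv f z ≠ 0) : AnalyticAt ℂ (f / deriv f) z := by
  by_cases hz : IsPoleAt f z
  · obtain ⟨n, hn0, hn, hn'⟩ := hz.exists_order
    refine MeromorphicAt.analyticAt_of_order_pos ?_ (by simp [hz.deriv_eq_zero])
    -- The order is `n - (n - 1) = 1`: `f / f'` has a simple zero at every pole.
    rw [meromorphicOrderAt_div hf.meromorphicAt hf.meromorphicAt.deriv, hn, hn']
    norm_cast
    norm_num
  · have := hf.analyticAt_of_not_isPoleAt hz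
    exact this.div this.deriv (h hz)

theorem MeromorphicNFAt.analyticAt_inv_deriv (hf : MeromorphicNFAt f z)
    (h : ¬ IsPoleAt f z → deriv f z ≠ 0) : AnalyticAt ℂ (deriv f)⁻¹ z := by
  by_cases hz : IsPoleAt f z
  · obtain ⟨n, hn0, hn, hn'⟩ := hz.exists_order
    refine MeromorphicAt.analyticAt_of_order_pos ?_ (by simp [hz.deriv_eq_zero])
    rw [meromorphicOrderAt_inv, hn']
    norm_cast
    omega
  · exact (hf.analyticAt_of_not_isPoleAt hz).deriv.inv (h hz)

/-- At a pole of `f`, the function `1 / f'` has a multiple zero. -/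
theorem IsPoleAt.deriv_inv_deriv_eq_zero (hf : MeromorphicNFAt f z) (hz : IsPoleAt f z) :
    deriv (deriv f)⁻¹ z = 0 := by
  obtain ⟨n, hn0, hn, hn'⟩ := hz.exists_order
  have ha := hf.analyticAt_inv_deriv (fun h => absurd hz h)
  have ho : meromorphicOrderAt (deriv f)⁻¹ z = (1 - n : ℤ) := by
    rw [meromorphicOrderAt_inv, hn']
    norm_cast
    ring
  have hd := meromorphicOrderAt_deriv_eq_sub_one (n := 1 - n)
    (by exact_mod_cast (by omega : (1 - n : ℤ) ≠ 0)) ho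
  have h0 : 0 < meromorphicOrderAt (deriv (deriv f)⁻¹) z := by
    rw [hd]
    norm_cast
    omega
  refine tendsto_nhds_unique (ha.deriv.continuousAt.tendsto.mono_left nhdsWithin_le_nhds)
    (tendsto_zero_of_meromorphicOrderAt_pos h0)

/-- Off the poles, `(f / f')' - 1 = f * (1 / f')'`. -/
theorem MeromorphicNFAt.deriv_div_deriv (hf : MeromorphicNFAt f z) (hz : ¬ IsPoleAt f z)
    (h : deriv f z ≠ 0) : deriv (f / deriv f) z - 1 = f z * deriv (deriv f)⁻¹ z := by
  have ha := hf.analyticAt_of_not_isPoleAt hz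
  rw [div_eq_mul_inv, deriv_mul ha.differentiableAt (ha.deriv.inv h).differentiableAt]
  simp [h]

end Derivative

/-! ### Zeros of the limit of `1 / f'` -/

section Limit

/-- If `u' v = u (v' - 1)` near a zero `x` of `u` and `v` is dominated by `u`, then `v' x ≠ 1`. -/
theorem deriv_ne_one_of_eq_zero {u v : ℂ → ℂ} {x : ℂ} {α C : ℝ} (hα : 1 < α)
    (hu : AnalyticAt ℂ u x) (hv : AnalyticAt ℂ v x)
    (h : ∀ᶠ z in 𝓝 x, deriv u z * v z = u z * (deriv v z - 1))
    (hle : ∀ᶠ z in 𝓝 x, ‖v z‖ ^ α ≤ C * ‖u z‖ ^ (α - 1)) (hx : u x = 0) :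
    deriv v x ≠ 1 := by
  intro h1
  have key : ∀ z, ‖v z‖ ^ α ≤ C * ‖u z‖ ^ (α - 1) → u z = 0 → v z = 0 := by
    intro z hz h0
    rw [h0, norm_zero, Real.zero_rpow (by linarith), mul_zero] at hz
    have := (Real.rpow_eq_zero (norm_nonneg (v z)) (by linarith)).1
      (le_antisymm hz (Real.rpow_nonneg (norm_nonneg _) _))
    exact norm_eq_zero.1 this
  have hvx : v x = 0 := key x hle.self_of_nhds hx
  have ou := hu.analyticOrderAt_deriv_add_one
  have ov := hv.analyticOrderAt_deriv_add_one
  simp only [hx, hvx, sub_zero] at ou ov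
  have hv' : analyticOrderAt (deriv v) x = 0 :=
    hv.deriv.analyticOrderAt_eq_zero.2 (by simp [h1])
  -- If `u` vanishes identically near `x`, so does `v`, contradicting `v' x = 1`. Otherwise, `v`
  -- having a simple zero, `u' v` has the order of `u`, whereas `u (v' - 1)` has a larger one.
  by_cases htop : analyticOrderAt u x = ⊤
  · have hv0 : v =ᶠ[𝓝 x] fun _ => (0 : ℂ) := by
      filter_upwards [analyticOrderAt_eq_top.1 htop, hle] with z hz hz'
      exact key z hz' hz
    simp [hv0.deriv_eq] at h1
  · have hw : AnalyticAt ℂ (fun z => deriv v z - 1) x := hv.deriv.sub analyticAt_const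
    have hw0 : analyticOrderAt (fun z => deriv v z - 1) x ≠ 0 := by
      rw [Ne, hw.analyticOrderAt_eq_zero]
      simp [h1]
    have e1 := analyticOrderAt_mul hu.deriv hv
    have e2 := analyticOrderAt_mul hu hw
    rw [analyticOrderAt_congr (show deriv u * v =ᶠ[𝓝 x] u * fun z => deriv v z - 1 from h),
      e2, ← ov, hv', zero_add, ou] at e1
    exact hw0 (ENat.add_right_injective_of_ne_top htop (e1.trans (add_zero _).symm))

end Limit

/-! ### Chordal estimates and localisation of spherical convergence -/

section Chordal

open Classical in
/-- The map `w ↦ 1 / w` from the plane to the Riemann sphere. -/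
noncomputable def sphereInv (w : ℂ) : OnePoint ℂ :=
  if w = 0 then OnePoint.infty else ((w⁻¹ : ℂ) : OnePoint ℂ)

theorem one_le_sqrt_one_add_sq (x : ℝ) : 1 ≤ Real.sqrt (1 + x ^ 2) :=
  Real.one_le_sqrt.2 (by nlinarith [sq_nonneg x])

theorem chordalDist_coe_le (a b : ℂ) : chordalDist (a : OnePoint ℂ) (b : OnePoint ℂ) ≤ ‖a - b‖ :=
  div_le_self (norm_nonneg _)
    (one_le_mul_of_one_le_of_one_le (one_le_sqrt_one_add_sq _) (one_le_sqrt_one_add_sq _))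

theorem one_div_sqrt_one_add_norm_inv_sq_le (a : ℂ) (ha : a ≠ 0) :
    1 / Real.sqrt (1 + ‖a⁻¹‖ ^ 2) ≤ ‖a‖ := by
  have h : ‖a⁻¹‖ ≤ Real.sqrt (1 + ‖a⁻¹‖ ^ 2) := Real.le_sqrt_of_sq_le (by linarith)
  have hp : 0 < ‖a⁻¹‖ := norm_pos_iff.2 (inv_ne_zero ha)
  calc 1 / Real.sqrt (1 + ‖a⁻¹‖ ^ 2) ≤ 1 / ‖a⁻¹‖ := one_div_le_one_div_of_le hp h
    _ = ‖a‖ := by simp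

/-- Inversion preserves the chordal metric, so convergence of `1 / f` in the plane gives spherical
convergence of `f`, even at poles. -/
theorem chordalDist_sphereInv_le (a b : ℂ) :
    chordalDist (sphereInv a) (sphereInv b) ≤ ‖a - b‖ := by
  by_cases ha : a = 0
  · by_cases hb : b = 0
    · simp only [sphereInv, ha, hb, if_true]
      exact norm_nonneg _
    · simp only [sphereInv, ha, hb, if_true, if_false, zero_sub, norm_neg]
      exact one_div_sqrt_one_add_norm_inv_sq_le b hb
  · by_cases hb : b = 0
    · simp only [sphereInv, ha, hb, if_true, if_false, sub_zero]
      exact one_div_sqrt_one_add_norm_inv_sq_le a ha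
    · simp only [sphereInv, ha, hb, if_false]
      change ‖a⁻¹ - b⁻¹‖ / (Real.sqrt (1 + ‖a⁻¹‖ ^ 2) * Real.sqrt (1 + ‖b⁻¹‖ ^ 2)) ≤ _
      have h1 : ‖a⁻¹‖ ≤ Real.sqrt (1 + ‖a⁻¹‖ ^ 2) := Real.le_sqrt_of_sq_le (by linarith)
      have h2 : ‖b⁻¹‖ ≤ Real.sqrt (1 + ‖b⁻¹‖ ^ 2) := Real.le_sqrt_of_sq_le (by linarith)
      have e : a⁻¹ - b⁻¹ = a⁻¹ * b⁻¹ * (b - a) := by field_simp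
      rw [e, norm_mul, norm_mul, norm_sub_rev b a, mul_comm]
      refine div_le_of_le_mul₀ (by positivity) (norm_nonneg _) ?_
      gcongr

theorem sphereValue_of_not_isPoleAt {f : ℂ → ℂ} {z : ℂ} (h : ¬ IsPoleAt f z) :
    sphereValue f z = (f z : OnePoint ℂ) := if_neg h

theorem sphereValue_of_isPoleAt {f : ℂ → ℂ} {z : ℂ} (h : IsPoleAt f z) :
    sphereValue f z = OnePoint.infty := if_pos h

/-- Spherical convergence on compact sets is a local property. -/
theorem convergesSpherically_of_forall_nhds {h : ℕ → ℂ → OnePoint ℂ} {g : ℂ → OnePoint ℂ}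
    {D : Set ℂ} (H : ∀ x ∈ D, ∀ ε : ℝ, 0 < ε →
      ∀ᶠ p : ℕ × ℂ in atTop ×ˢ 𝓝 x, chordalDist (h p.1 p.2) (g p.2) < ε) :
    ConvergesSpherically h g D := by
  intro K hKD hK ε hε
  suffices ∀ᶠ n in atTop, ∀ z ∈ K, chordalDist (h n z) (g z) < ε from eventually_atTop.1 this
  refine hK.induction_on (p := fun K => ∀ᶠ n in atTop, ∀ z ∈ K, chordalDist (h n z) (g z) < ε)
    (by simp) (fun s t hst ht => ht.mono fun n hn z hz => hn z (hst hz)) (fun s t hs ht => ?_)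
    fun x hx => ?_
  · filter_upwards [hs, ht] with n hn hn' z hz
    exact hz.elim (hn z) (hn' z)
  · obtain ⟨p, hp, q, hq, hpq⟩ := eventually_prod_iff.1 (H x (hKD hx) ε hε)
    exact ⟨{z | q z}, mem_nhdsWithin_of_mem_nhds hq, hp.mono fun n hn z hz => hpq hn hz⟩

end Chordal

/-! ### Bounds and identities for members of the family -/

section Family

variable {α C : ℝ} {D : Set ℂ} {f : ℂ → ℂ} {z : ℂ}

theorem deriv_ne_zero_of_mem_derivGrowthFamily (hC : 0 < C) (hf : f ∈ derivGrowthFamily α C D)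
    (hz : z ∈ D) (hp : ¬ IsPoleAt f z) : deriv f z ≠ 0 := by
  intro h
  have := hf.2 z hz hp
  rw [h, norm_zero, zero_div] at this
  exact lt_asymm hC this

theorem one_add_rpow_mul_norm_inv_deriv_le (hC : 0 < C) (hf : f ∈ derivGrowthFamily α C D)
    (hz : z ∈ D) : (1 + ‖f z‖ ^ α) * ‖(deriv f)⁻¹ z‖ ≤ C⁻¹ := by
  by_cases hp : IsPoleAt f z
  · simp [hp.deriv_eq_zero, hC.le]
  · have h0 := norm_pos_iff.2 (deriv_ne_zero_of_mem_derivGrowthFamily hC hf hz hp)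
    have h1 : 0 < 1 + ‖f z‖ ^ α := by positivity
    have := hf.2 z hz hp
    rw [lt_div_iff₀ h1] at this
    rw [Pi.inv_apply, norm_inv, ← div_eq_mul_inv, div_le_iff₀ h0, inv_mul_eq_div, le_div_iff₀ hC]
    linarith

theorem norm_inv_deriv_le (hC : 0 < C) (hf : f ∈ derivGrowthFamily α C D) (hz : z ∈ D) :
    ‖(deriv f)⁻¹ z‖ ≤ C⁻¹ := by
  have h := one_add_rpow_mul_norm_inv_deriv_le hC hf hz
  have : 0 ≤ ‖f z‖ ^ α * ‖(deriv f)⁻¹ z‖ := by positivity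
  linarith

theorem norm_div_deriv_le (hα : 1 < α) (hC : 0 < C) (hf : f ∈ derivGrowthFamily α C D)
    (hz : z ∈ D) : ‖(f / deriv f) z‖ ≤ C⁻¹ := by
  refine le_trans ?_ (one_add_rpow_mul_norm_inv_deriv_le hC hf hz)
  rw [div_eq_mul_inv, Pi.mul_apply, norm_mul]
  refine mul_le_mul_of_nonneg_right ?_ (norm_nonneg _)
  rcases le_total ‖f z‖ 1 with h | h
  · exact h.trans (le_add_of_nonneg_right (by positivity))
  · exact (Real.self_le_rpow_of_one_le h hα.le).trans (by linarith)

/-- Write `|f / f'| ^ α = (|f| ^ α |1 / f'|) |1 / f'| ^ (α - 1)`; the growth condition bounds the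
bracket. Unlike the growth condition, this form no longer mentions `f` and passes to the limit. -/
theorem norm_div_deriv_rpow_le (hα : 1 < α) (hC : 0 < C) (hf : f ∈ derivGrowthFamily α C D)
    (hz : z ∈ D) : ‖(f / deriv f) z‖ ^ α ≤ C⁻¹ * ‖(deriv f)⁻¹ z‖ ^ (α - 1) := by
  have h := one_add_rpow_mul_norm_inv_deriv_le hC hf hz
  set t := ‖(deriv f)⁻¹ z‖ with ht
  have ht0 : 0 ≤ t := norm_nonneg _
  have e : t ^ α = t * t ^ (α - 1) := by
    rw [← Real.rpow_one_add' ht0 (by linarith)]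
    congr 1
    ring
  rw [div_eq_mul_inv, Pi.mul_apply, norm_mul, ← ht, Real.mul_rpow (norm_nonneg _) ht0, e,
    ← mul_assoc]
  refine mul_le_mul_of_nonneg_right ?_ (by positivity)
  linarith

theorem analyticAt_inv_deriv_of_mem (hC : 0 < C) (hf : f ∈ derivGrowthFamily α C D)
    (hz : z ∈ D) : AnalyticAt ℂ (deriv f)⁻¹ z :=
  (hf.1 hz).analyticAt_inv_deriv (deriv_ne_zero_of_mem_derivGrowthFamily hC hf hz)

theorem analyticAt_div_deriv_of_mem (hC : 0 < C) (hf : f ∈ derivGrowthFamily α C D)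
    (hz : z ∈ D) : AnalyticAt ℂ (f / deriv f) z :=
  (hf.1 hz).analyticAt_div_deriv (deriv_ne_zero_of_mem_derivGrowthFamily hC hf hz)

theorem deriv_inv_deriv_mul (hC : 0 < C) (hf : f ∈ derivGrowthFamily α C D) (hz : z ∈ D) :
    deriv (deriv f)⁻¹ z * (f / deriv f) z =
      (deriv f)⁻¹ z * (deriv (f / deriv f) z - 1) := by
  by_cases hp : IsPoleAt f z
  · simp [hp.deriv_eq_zero]
  · rw [(hf.1 hz).deriv_div_deriv hp (deriv_ne_zero_of_mem_derivGrowthFamily hC hf hz hp)]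
    simp only [Pi.div_apply, Pi.inv_apply, div_eq_mul_inv]
    ring

/-- Where `1 / f' ≠ 0`, the spherical value of `f` is the quotient of `f / f'` and `1 / f'`. -/
theorem sphereValue_eq_div (h : (deriv f)⁻¹ z ≠ 0) :
    sphereValue f z = (((f / deriv f) z / (deriv f)⁻¹ z : ℂ) : OnePoint ℂ) := by
  have hp : ¬ IsPoleAt f z := fun hp => h (by simp [hp.deriv_eq_zero])
  have h' : deriv f z ≠ 0 := by simpa using h
  rw [sphereValue_of_not_isPoleAt hp]
  simp [h']

/-- Where `(f / f')' ≠ 1`, the spherical value of `f` is the inverse of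
`(1 / f')' / ((f / f')' - 1)`. -/
theorem sphereValue_eq_sphereInv (hC : 0 < C) (hf : f ∈ derivGrowthFamily α C D) (hz : z ∈ D)
    (h : deriv (f / deriv f) z - 1 ≠ 0) :
    sphereValue f z = sphereInv (deriv (deriv f)⁻¹ z / (deriv (f / deriv f) z - 1)) := by
  by_cases hp : IsPoleAt f z
  · rw [sphereValue_of_isPoleAt hp, hp.deriv_inv_deriv_eq_zero (hf.1 hz), zero_div]
    simp [sphereInv]
  · have e := (hf.1 hz).deriv_div_deriv hp
      (deriv_ne_zero_of_mem_derivGrowthFamily hC hf hz hp)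
    rw [e] at h ⊢
    have h1 := left_ne_zero_of_mul h
    have h2 := right_ne_zero_of_mul h
    rw [sphereValue_of_not_isPoleAt hp, sphereInv, if_neg (div_ne_zero h2 h)]
    congr 1
    field_simp

end Family

/-! ### Passage to the limit and conclusion -/

theorem TendstoLocallyUniformlyOn.tendsto_prod_nhds {D : Set ℂ} (hD : IsOpen D)
    {F : ℕ → ℂ → ℂ} {f : ℂ → ℂ} (h : TendstoLocallyUniformlyOn F f atTop D) {x : ℂ} (hx : x ∈ D)
    (hf : ContinuousAt f x) :
    Tendsto (fun p : ℕ × ℂ => F p.1 p.2) (atTop ×ˢ 𝓝 x) (𝓝 (f x)) :=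
  (hf.tendsto.comp tendsto_snd).congr_uniformity
    (hD.tendstoLocallyUniformlyOn_iff_forall_tendsto.1 h x hx)

theorem eventually_norm_sub_lt_of_tendsto {ι : Type*} {l : Filter ι} {a b : ι → ℂ} {c : ℂ}
    (ha : Tendsto a l (𝓝 c)) (hb : Tendsto b l (𝓝 c)) {ε : ℝ} (hε : 0 < ε) :
    ∀ᶠ i in l, ‖a i - b i‖ < ε := by
  have := (ha.sub hb).norm
  rw [sub_self, norm_zero] at this
  exact this.eventually_lt_const hε

theorem theorem1 (D : Set ℂ) (hD : IsOpen D) (hDc : IsConnected D) (α C : ℝ)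
    (hα : 1 < α) (hC : 0 < C) : IsNormalFamily (derivGrowthFamily α C D) D := by
  intro w hw
  obtain ⟨φ, u, hφ, hu⟩ := exists_subseq_tendstoLocallyUniformlyOn hD
    (F := fun n => (deriv (w n))⁻¹) (M := C⁻¹)
    (fun n z hz => (analyticAt_inv_deriv_of_mem hC (hw n) hz).differentiableAt.differentiableWithinAt)
    (fun n z hz => norm_inv_deriv_le hC (hw n) hz)
  obtain ⟨ψ, v, hψ, hv⟩ := exists_subseq_tendstoLocallyUniformlyOn hD
    (F := fun n => w (φ n) / deriv (w (φ n))) (M := C⁻¹)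
    (fun n z hz =>
      (analyticAt_div_deriv_of_mem hC (hw (φ n)) hz).differentiableAt.differentiableWithinAt)
    (fun n z hz => norm_div_deriv_le hα hC (hw (φ n)) hz)
  set f : ℕ → ℂ → ℂ := fun n => w (φ (ψ n))
  have hf : ∀ n, f n ∈ derivGrowthFamily α C D := fun n => hw _
  have hu : TendstoLocallyUniformlyOn (fun n => (deriv (f n))⁻¹) u atTop D := fun s hs x hx =>
    let ⟨t, ht, h⟩ := hu s hs x hx
    ⟨t, ht, hψ.tendsto_atTop.eventually h⟩
  replace hv : TendstoLocallyUniformlyOn (fun n => f n / deriv (f n)) v atTop D := hv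
  have hUd : ∀ n, DifferentiableOn ℂ (deriv (f n))⁻¹ D := fun n z hz =>
    (analyticAt_inv_deriv_of_mem hC (hf n) hz).differentiableAt.differentiableWithinAt
  have hVd : ∀ n, DifferentiableOn ℂ (f n / deriv (f n)) D := fun n z hz =>
    (analyticAt_div_deriv_of_mem hC (hf n) hz).differentiableAt.differentiableWithinAt
  have hu' := hu.deriv (.of_forall hUd) hD
  have hv' := hv.deriv (.of_forall hVd) hD
  have hua : ∀ x ∈ D, AnalyticAt ℂ u x := fun x hx =>
    (hu.differentiableOn (.of_forall hUd) hD).analyticAt (hD.mem_nhds hx)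
  have hva : ∀ x ∈ D, AnalyticAt ℂ v x := fun x hx =>
    (hv.differentiableOn (.of_forall hVd) hD).analyticAt (hD.mem_nhds hx)
  have hode : ∀ z ∈ D, deriv u z * v z = u z * (deriv v z - 1) := fun z hz =>
    tendsto_nhds_unique ((hu'.tendsto_at hz).mul (hv.tendsto_at hz)) <|
      ((hu.tendsto_at hz).mul ((hv'.tendsto_at hz).sub_const 1)).congr fun n =>
        (deriv_inv_deriv_mul hC (hf n) hz).symm
  have hle : ∀ z ∈ D, ‖v z‖ ^ α ≤ C⁻¹ * ‖u z‖ ^ (α - 1) := fun z hz =>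
    le_of_tendsto_of_tendsto'
      ((hv.tendsto_at hz).norm.rpow_const (.inr (by linarith)))
      (((hu.tendsto_at hz).norm.rpow_const (.inr (by linarith))).const_mul _)
      fun n => norm_div_deriv_rpow_le hα hC (hf n) hz
  -- This also covers `u` identically zero: then `u' = 0` and the limit is `∞`.
  refine ⟨fun n => φ (ψ n), fun z => if u z = 0 then sphereInv (deriv u z / (deriv v z - 1))
    else ((v z / u z : ℂ) : OnePoint ℂ), hφ.comp hψ, ?_⟩
  refine convergesSpherically_of_forall_nhds fun x hx ε hε => ?_
  have hDx : ∀ᶠ p : ℕ × ℂ in atTop ×ˢ 𝓝 x, p.2 ∈ D :=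
    tendsto_snd.eventually (hD.mem_nhds hx)
  by_cases hux : u x = 0
  · have hvx : deriv v x - 1 ≠ 0 := sub_ne_zero.2 <|
      deriv_ne_one_of_eq_zero hα (hua x hx) (hva x hx)
        (eventually_of_mem (hD.mem_nhds hx) hode) (eventually_of_mem (hD.mem_nhds hx) hle) hux
    have cu := (hua x hx).deriv.continuousAt
    have cv := (hva x hx).deriv.continuousAt
    have tu := hu'.tendsto_prod_nhds hD hx cu
    have tv := (hv'.tendsto_prod_nhds hD hx cv).sub_const 1
    have su : Tendsto (fun p : ℕ × ℂ => deriv u p.2) (atTop ×ˢ 𝓝 x) (𝓝 (deriv u x)) :=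
      cu.tendsto.comp tendsto_snd
    have sv : Tendsto (fun p : ℕ × ℂ => deriv v p.2 - 1) (atTop ×ˢ 𝓝 x) (𝓝 (deriv v x - 1)) :=
      (cv.tendsto.comp tendsto_snd).sub_const 1
    filter_upwards [hDx, tv.eventually_ne hvx, sv.eventually_ne hvx,
      eventually_norm_sub_lt_of_tendsto (tu.div tv hvx) (su.div sv hvx) hε] with p hpD h1 h2 hlt
    have e1 : sphereValue (w (φ (ψ p.1))) p.2 = _ :=
      sphereValue_eq_sphereInv hC (hf p.1) hpD h1
    -- Points near `x` may have `u ≠ 0`; there `u' v = u (v' - 1)` shows that the two formulas for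
    -- the limit agree.
    have e2 : (if u p.2 = 0 then sphereInv (deriv u p.2 / (deriv v p.2 - 1))
        else ((v p.2 / u p.2 : ℂ) : OnePoint ℂ)) =
        sphereInv (deriv u p.2 / (deriv v p.2 - 1)) := by
      split_ifs with h
      · rfl
      · have hne : deriv u p.2 * v p.2 ≠ 0 := by
          rw [hode p.2 hpD]
          exact mul_ne_zero h h2
        have hu1 := left_ne_zero_of_mul hne
        rw [sphereInv, if_neg (div_ne_zero hu1 h2), inv_div]
        congr 1
        rw [div_eq_div_iff h hu1, mul_comm, hode p.2 hpD, mul_comm]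
    rw [e1, e2]
    exact (chordalDist_sphereInv_le _ _).trans_lt hlt
  · have cu := (hua x hx).continuousAt
    have cv := (hva x hx).continuousAt
    have tu := hu.tendsto_prod_nhds hD hx cu
    have tv := hv.tendsto_prod_nhds hD hx cv
    have su : Tendsto (fun p : ℕ × ℂ => u p.2) (atTop ×ˢ 𝓝 x) (𝓝 (u x)) :=
      cu.tendsto.comp tendsto_snd
    have sv : Tendsto (fun p : ℕ × ℂ => v p.2) (atTop ×ˢ 𝓝 x) (𝓝 (v x)) :=
      cv.tendsto.comp tendsto_snd
    filter_upwards [tu.eventually_ne hux, su.eventually_ne hux,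
      eventually_norm_sub_lt_of_tendsto (tv.div tu hux) (sv.div su hux) hε] with p h1 h2 hlt
    have e1 : sphereValue (w (φ (ψ p.1))) p.2 = _ := sphereValue_eq_div (f := f p.1) h1
    rw [e1, if_neg h2]
    exact (chordalDist_coe_le _ _).trans_lt hlt
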